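/- Let $G=(V,E)$ be a finite simple graph that is maximal planar, i.e. $G$ can be drawn in the plane without crossings, but no edge can be added to it on the same vertex set without destroying this property. Let $K$ be the set of its 3-cliques (sets of three mutually adjacent vertices, regarded as induced subgraphs). Removing $k\in K$ divides $G$ into two disjoint, possibly empty, induced subgraphs $S,S'$ whose vertex sets together make up $V\setminus k$ and such that every path of $G$ from $S$ to $S'$ contains a vertex of $k$; both $S$ and $S'$ are taken non-empty whenever such a division into two non-empty subgraphs exists (that is, whenever $k$ is separating). The one of $S,S'$ with fewer vertices is the interior $G^k_{in}$ of $k$ and the other one is its exterior; if the numbers of vertices are equal, the interior is chosen arbitrarily among the two. The union of two subgraphs of $G$ means the subgraph of $G$ induced on the union of their vertex sets. For $k_i,k_j\in K$ write $G^i_{in}$, $G^j_{in}$ for their interiors and define $$k_i\preceq_K k_j \iff (k_i\cup G^i_{in})\subseteq(k_j\cup G^j_{in}).$$ Then, for every choice of the interiors as above, $\preceq_K$ is a partial order on $K$: for all $k_i,k_j,k_m\in K$, 1. (reflexivity) $k_i\preceq_K k_i$; 2. (antisymmetry) $k_i\preceq_K k_j$ and $k_j\preceq_K k_i$ imply $k_i=k_j$;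 3. (transitivity) $k_i\preceq_K k_j$ and $k_j\preceq_K k_m$ imply $k_i\preceq_K k_m$. -/

import Mathlib

/-- The Euclidean plane. -/
abbrev Plane : Type := EuclideanSpace ℝ (Fin 2)

/-- `s` is a (simple) polygonal arc from `p` to `q`: the union of the straight segments
`[c 0, c 1], [c 1, c 2], …, [c (n-1), c n]`, where `c 0 = p`, `c n = q`, `n ≥ 1`, the corners
`c 0, …, c n` are distinct, and two different segments never meet, except that two consecutive
ones share their common corner. -/
def IsPolygonalArc (p q : Plane) (s : Set Plane) : Prop :=
  ∃ (n : ℕ) (c : ℕ → Plane), 0 < n ∧ c 0 = p ∧ c n = q ∧ Set.InjOn c (Set.Iic n) ∧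
    (∀ i j : ℕ, i < j → j < n → ∀ x : Plane,
      x ∈ segment ℝ (c i) (c (i + 1)) → x ∈ segment ℝ (c j) (c (j + 1)) →
        j = i + 1 ∧ x = c j) ∧
    s = ⋃ i ∈ Set.Iio n, segment ℝ (c i) (c (i + 1))

namespace SimpleGraph

variable {V : Type*}

/-- A drawing of `G` in the plane without crossings: vertices are distinct points, every edge is a
polygonal arc between its two endvertices, the interior of an edge contains no vertex and no point
of any other edge. -/
structure PlaneDrawing (G : SimpleGraph V) where
  pos : V → Plane
  edge : Sym2 V → Set Plane
  pos_injective : Function.Injective pos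
  edge_isArc : ∀ u v : V, G.Adj u v → IsPolygonalArc (pos u) (pos v) (edge s(u, v))
  mem_of_pos_mem_edge : ∀ e ∈ G.edgeSet, ∀ w : V, pos w ∈ edge e → w ∈ e
  edge_inter_edge : ∀ e ∈ G.edgeSet, ∀ f ∈ G.edgeSet, e ≠ f →
    ∀ x : Plane, x ∈ edge e → x ∈ edge f → ∃ w : V, w ∈ e ∧ w ∈ f ∧ x = pos w

/-- A graph is planar if it can be drawn in the plane without crossings. -/
def IsPlanar (G : SimpleGraph V) : Prop := Nonempty G.PlaneDrawing

/-- A graph is maximal planar if it is planar and no edge can be added to it (on the same vertex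
set) without destroying planarity. -/
def IsMaximalPlanar (G : SimpleGraph V) : Prop :=
  Maximal (fun H : SimpleGraph V => H.IsPlanar) G

variable (G : SimpleGraph V)

/-- The set `K` of 3-cliques of `G`, each given by its set of three mutually adjacent vertices. -/
abbrev ThreeClique : Type _ := {k : Finset V // G.IsNClique 3 k}

variable {G}

/-- The 3-clique as a subgraph of `G`. -/
def ThreeClique.toSubgraph (k : G.ThreeClique) : G.Subgraph :=
  (⊤ : G.Subgraph).induce (k.1 : Set V)

/-- The union operator on subgraphs of `G` used here: a vertex belongs to the union iff it belongs
to one of the two subgraphs, and two vertices of the union are adjacent in it iff they are adjacent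
in `G`. -/
def Subgraph.fullUnion (S₁ S₂ : G.Subgraph) : G.Subgraph :=
  (⊤ : G.Subgraph).induce (S₁.verts ∪ S₂.verts)

/-- Removing the vertices of `k` divides `G` into the induced subgraphs `S` and `S'`
(one of them or both may be empty): their vertex sets partition the vertices outside `k`, and every
path of `G` from `S` to `S'` includes a vertex of `k`. -/
structure ThreeClique.Divides (k : G.ThreeClique) (S S' : G.Subgraph) : Prop where
  isInduced_left : S.IsInduced
  isInduced_right : S'.IsInduced
  union_verts : S.verts ∪ S'.verts = (k.1 : Set V)ᶜ
  disjoint_verts : Disjoint S.verts S'.verts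
  path_meets : ∀ i ∈ S.verts, ∀ j ∈ S'.verts, ∀ p : G.Walk i j, p.IsPath →
    ∃ v ∈ p.support, v ∈ k.1

/-- The 3-clique `k` is separating if its removal divides `G` into two non-empty subgraphs. -/
def ThreeClique.IsSeparating (k : G.ThreeClique) : Prop :=
  ∃ S S' : G.Subgraph, S.verts.Nonempty ∧ S'.verts.Nonempty ∧ k.Divides S S'

/-- `Gin` and `Gout` are admissible as interior and exterior of `k`: they are the two subgraphs
obtained by removing `k` (both non-empty if `k` is separating; if `k` is non-separating, then
`Divides` forces one of them to be empty), and the order of `Gin` is at most that of `Gout`.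
If the two orders are equal, both assignments are admissible. -/
structure ThreeClique.IsInteriorExterior (k : G.ThreeClique) (Gin Gout : G.Subgraph) : Prop where
  divides : k.Divides Gin Gout
  nonempty_of_isSeparating : k.IsSeparating → Gin.verts.Nonempty ∧ Gout.verts.Nonempty
  order_le : Gin.verts.ncard ≤ Gout.verts.ncard

/-- The relation `kᵢ ≼ kⱼ`: the subgraph `kᵢ ∪ Gⁱ_in` is contained in `kⱼ ∪ Gʲ_in`, where the
interior of each 3-clique is given by `Gin`. -/
def CliqueLE (Gin : G.ThreeClique → G.Subgraph) (k₁ k₂ : G.ThreeClique) : Prop :=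
  k₁.toSubgraph.fullUnion (Gin k₁) ≤ k₂.toSubgraph.fullUnion (Gin k₂)

end SimpleGraph

/-! Reflexivity and transitivity come from the order on subgraphs; antisymmetry is the content.
Suppose k₁ ≠ k₂ have the same closed interior. Then their exteriors have the same vertex set O, and
every neighbour of O outside O lies in k₁ ∩ k₂. O is non-empty, so connectedness of G gives an edge
from some u in O to some a in k₁ ∩ k₂. Choose c in k₁ but not in k₂, and let d be the third vertex
of k₁. Then u and c are neighbours of a, and `exists_adj_compl_pair` says that deleting the adjacent
vertices a, d leaves an edge from O to some y outside O. This y lies in k₁ ∩ k₂, so it must be c,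
which is not in k₂: a contradiction.

Both graph facts come from one principle that needs no Jordan curve theorem: two vertices touching a
common face are adjacent, since otherwise an edge could be drawn through the face
(`isPlanar_sup_edge`). If a connected open region meets the drawing only in edges and vertices
around A or around B, and meets both, some face touches both
(`exists_component_closure_meets_both`). That face also touches a vertex of A and one of B, because
contact with a face propagates along an edge (`right_mem_closure_component`). The whole plane as
region gives connectedness; a small disc about a, slit along the edge ad, gives the statement about
a and d. -/

open Set Filter Topology

/-! ### Rays, segments and slit balls -/

section Plane

variable {E : Type*} [NormedAddCommGroup E] [NormedSpace ℝ E]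

/-- The ray from `z` through `y`. -/
def rayFrom (z y : E) : Set E := {w | ∃ t : ℝ, 0 ≤ t ∧ w = z + t • (y - z)}

theorem mem_segment_iff_add_smul {z y w : E} :
    w ∈ segment ℝ z y ↔ ∃ t : ℝ, 0 ≤ t ∧ t ≤ 1 ∧ w = z + t • (y - z) := by
  rw [segment_eq_image']
  constructor
  · rintro ⟨t, ⟨h0, h1⟩, rfl⟩
    exact ⟨t, h0, h1, rfl⟩
  · rintro ⟨t, h0, h1, rfl⟩
    exact ⟨t, ⟨h0, h1⟩, rfl⟩

theorem segment_subset_rayFrom (z y : E) : segment ℝ z y ⊆ rayFrom z y := by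
  intro w hw
  obtain ⟨t, h0, -, rfl⟩ := mem_segment_iff_add_smul.1 hw
  exact ⟨t, h0, rfl⟩

theorem self_mem_rayFrom (z y : E) : z ∈ rayFrom z y := ⟨0, le_rfl, by simp⟩

theorem mem_segment_of_mem_rayFrom {z y w : E} (hy : y ≠ z) (hw : w ∈ rayFrom z y)
    (hd : dist w z ≤ dist y z) : w ∈ segment ℝ z y := by
  obtain ⟨t, h0, rfl⟩ := hw
  refine mem_segment_iff_add_smul.2 ⟨t, h0, ?_, rfl⟩
  rw [dist_eq_norm, dist_eq_norm, add_sub_cancel_left, norm_smul, Real.norm_of_nonneg h0] at hd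
  have : 0 < ‖y - z‖ := norm_pos_iff.2 (sub_ne_zero.2 hy)
  by_contra hlt
  push Not at hlt
  nlinarith

theorem isClosed_rayFrom (z y : E) : IsClosed (rayFrom z y) := by
  by_cases hy : y = z
  · have : rayFrom z y = {z} := by
      ext w
      simp only [rayFrom, hy, sub_self, smul_zero, add_zero, mem_ofPred_eq, mem_singleton_iff]
      exact ⟨fun ⟨_, _, h⟩ => h, fun h => ⟨0, le_rfl, h⟩⟩
    rw [this]
    exact isClosed_singleton
  · have hc : IsClosedEmbedding (fun t : ℝ => z + t • (y - z)) :=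
      (Homeomorph.addLeft z).isClosedEmbedding.comp
        (isClosedEmbedding_smul_left (sub_ne_zero.2 hy))
    have : rayFrom z y = (fun t : ℝ => z + t • (y - z)) '' Ici 0 := by
      ext w
      exact ⟨fun ⟨t, h, e⟩ => ⟨t, h, e.symm⟩, fun ⟨t, h, e⟩ => ⟨t, h, e.symm⟩⟩
    rw [this]
    exact hc.isClosedMap _ isClosed_Ici

/-- A ball with a slit along a ray from its centre is connected. -/
theorem isPreconnected_ball_diff_rayFrom {z y : E} (hy : y ≠ z) {r : ℝ} (hr : 0 < r) :
    IsPreconnected (Metric.ball z r \ rayFrom z y) := by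
  have hn : 0 < ‖y - z‖ := norm_pos_iff.2 (sub_ne_zero.2 hy)
  -- The star centre z - s(y - z) lies opposite the slit, at distance r/2 from z. If a point
  -- strictly between it and x, or x itself, were on the ray, then x would be too.
  set s : ℝ := r / (2 * ‖y - z‖) with hs
  have hs0 : 0 < s := by positivity
  have hb : z - s • (y - z) ∈ Metric.ball z r := by
    rw [Metric.mem_ball, dist_eq_norm, sub_sub_cancel_left, norm_neg, norm_smul,
      Real.norm_of_nonneg hs0.le, hs]
    field_simp
    linarith
  have hstar : StarConvex ℝ (z - s • (y - z)) (Metric.ball z r \ rayFrom z y) := by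
    rintro x ⟨hx, hxr⟩ a b ha hb' hab
    refine ⟨convex_ball z r hb hx ha hb' hab, ?_⟩
    rintro ⟨t, ht, h⟩
    rcases hb'.eq_or_lt with rfl | hb0
    · have ha1 : a = 1 := by linarith
      subst ha1
      have : (t + s) • (y - z) = 0 := by
        rw [add_smul]
        simp only [one_smul, zero_smul, add_zero] at h
        rw [sub_eq_iff_eq_add, add_assoc] at h
        simpa using h.symm
      rcases smul_eq_zero.1 this with h' | h'
      · linarith
      · exact sub_ne_zero.2 hy h'
    · refine hxr ⟨(t + a * s) / b, by positivity, ?_⟩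
      have h2 : b • x = b • z + (t + a * s) • (y - z) := by
        have : b • x = z + t • (y - z) - a • (z - s • (y - z)) := by rw [← h]; abel
        rw [this]
        have hb1 : b = 1 - a := by linarith
        rw [hb1]
        module
      have h3 : x = b⁻¹ • (b • x) := by rw [smul_smul, inv_mul_cancel₀ hb0.ne', one_smul]
      rw [h3, h2, smul_add, smul_smul, smul_smul, inv_mul_cancel₀ hb0.ne', one_smul,
        div_eq_inv_mul]
  refine (hstar.isPathConnected ⟨hb, ?_⟩).isConnected.isPreconnected
  rintro ⟨t, ht, h⟩
  have : (t + s) • (y - z) = 0 := by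
    rw [add_smul]
    rw [sub_eq_iff_eq_add, add_assoc] at h
    simpa using h.symm
  rcases smul_eq_zero.1 this with h' | h'
  · linarith
  · exact sub_ne_zero.2 hy h'

theorem notMem_rayFrom_of_segment_inter {z y₁ y₂ : E}
    (h : ∀ w ∈ segment ℝ z y₁, w ∈ segment ℝ z y₂ → w = z) (h₁ : y₁ ≠ z)
    {t : ℝ} (ht : 0 < t) : z + t • (y₁ - z) ∉ rayFrom z y₂ := by
  rintro ⟨s, hs, e⟩
  have e' : t • (y₁ - z) = s • (y₂ - z) := add_left_cancel e
  -- Scaling towards z by m brings a common point of the rays into both segments.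
  set m : ℝ := (1 + t + s)⁻¹ with hm
  have hm0 : 0 < m := by positivity
  have hmt : m * t ≤ 1 := by
    rw [hm, inv_mul_le_iff₀ (by positivity)]; linarith
  have hms : m * s ≤ 1 := by
    rw [hm, inv_mul_le_iff₀ (by positivity)]; linarith
  have := h (z + (m * t) • (y₁ - z))
    (mem_segment_iff_add_smul.2 ⟨m * t, by positivity, hmt, rfl⟩)
    (mem_segment_iff_add_smul.2 ⟨m * s, by positivity, hms, by rw [mul_smul, e', mul_smul]⟩)
  rw [add_eq_left, smul_eq_zero] at this
  rcases this with h' | h'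
  · exact (mul_pos hm0 ht).ne' h'
  · exact sub_ne_zero.2 h₁ h'

theorem segment_subset_union_of_mem {u v z : E} (hz : z ∈ segment ℝ u v) :
    segment ℝ u v ⊆ segment ℝ z u ∪ segment ℝ z v := by
  rw [segment_symm ℝ z u]
  intro w hw
  obtain ⟨a, ha0, ha1, rfl⟩ := mem_segment_iff_add_smul.1 hz
  obtain ⟨b, hb0, hb1, rfl⟩ := mem_segment_iff_add_smul.1 hw
  rcases le_total b a with h | h
  · left
    rcases ha0.eq_or_lt with rfl | ha0
    · obtain rfl : b = 0 := le_antisymm h hb0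
      simp
    · refine mem_segment_iff_add_smul.2 ⟨b / a, by positivity, (div_le_one ha0).2 h, ?_⟩
      rw [add_sub_cancel_left, smul_smul, div_mul_cancel₀ _ ha0.ne']
  · right
    rcases ha1.eq_or_lt with rfl | ha1
    · obtain rfl : b = 1 := le_antisymm hb1 h
      simp
    · refine mem_segment_iff_add_smul.2 ⟨(b - a) / (1 - a),
        div_nonneg (by linarith) (by linarith), (div_le_one (by linarith)).2 (by linarith), ?_⟩
      have h1 : v - (u + a • (v - u)) = (1 - a) • (v - u) := by module
      rw [h1, smul_smul, div_mul_cancel₀ _ (by linarith : (1 - a) ≠ 0)]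
      module

theorem eq_of_mem_segment_of_mem_segment {u v z w : E} (hz : z ∈ segment ℝ u v)
    (hu : w ∈ segment ℝ z u) (hv : w ∈ segment ℝ z v) : w = z := by
  obtain ⟨a, ha0, ha1, rfl⟩ := mem_segment_iff_add_smul.1 hz
  obtain ⟨s, hs0, hs1, rfl⟩ := mem_segment_iff_add_smul.1 hu
  obtain ⟨t, ht0, ht1, e⟩ := mem_segment_iff_add_smul.1 hv
  have h : (s * a + t * (1 - a)) • (v - u) = 0 := by
    have e' := sub_eq_zero.2 e.symm
    rw [← e']
    module
  have h2 : (s * a) • (v - u) = 0 := by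
    rcases smul_eq_zero.1 h with h | h
    · have : s * a = 0 := by
        have h3 := mul_nonneg hs0 ha0
        have h4 := mul_nonneg ht0 (sub_nonneg.2 ha1)
        linarith
      rw [this, zero_smul]
    · rw [h, smul_zero]
  have h5 : s • (u - (u + a • (v - u))) = -((s * a) • (v - u)) := by module
  rw [h5, h2, neg_zero, add_zero]

theorem isCompact_segment (u v : E) : IsCompact (segment ℝ u v) := by
  rw [segment_eq_image']
  exact isCompact_Icc.image (by fun_prop)

/-! ### Locally radial sets -/

/-- `D` is locally radial if, close to any point `z`, every point outside `D` sees `z` without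
crossing `D`. -/
def LocallyRadial (D : Set E) : Prop :=
  ∀ z, ∀ᶠ y in 𝓝 z, y ∉ D → openSegment ℝ z y ⊆ Dᶜ

/-- For z on the segment, the segment splits into [z,u] and [z,v]. If y is closer to z than the
non-trivial ends and the open segment from z to y meets one of these pieces, then y itself lies on
it. -/
theorem locallyRadial_segment (u v : E) : LocallyRadial (segment ℝ u v) := by
  intro z
  by_cases hz : z ∈ segment ℝ u v
  · have hev : ∀ q : E, ∀ᶠ y in 𝓝 z, q ≠ z → dist y z < dist q z := by
      intro q
      by_cases hq : q = z
      · exact Eventually.of_forall fun _ h => absurd hq h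
      · filter_upwards [Metric.ball_mem_nhds z (dist_pos.2 hq)] with y hy _ using hy
    have key : ∀ q : E, q ∈ segment ℝ u v → ∀ y : E, (q ≠ z → dist y z < dist q z) →
        ∀ w, w ∈ segment ℝ z q → w ∈ openSegment ℝ z y → y ∈ segment ℝ u v := by
      intro q hq y hy w hw hwy
      rw [openSegment_eq_image'] at hwy
      obtain ⟨τ, ⟨h0, h1⟩, rfl⟩ := hwy
      by_cases hqz : q = z
      · subst hqz
        rw [segment_same, mem_singleton_iff] at hw
        have hw' : τ • (y - q) = 0 := by simpa using hw
        rcases smul_eq_zero.1 hw' with h | h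
        · exact absurd h h0.ne'
        · rw [sub_eq_zero.1 h]; exact hz
      · obtain ⟨s, hs0, hs1, e⟩ := mem_segment_iff_add_smul.1 hw
        have e' : τ • (y - z) = s • (q - z) := add_left_cancel e
        have : y ∈ rayFrom z q := by
          refine ⟨s / τ, by positivity, ?_⟩
          rw [div_eq_inv_mul, mul_smul, ← e', smul_smul, inv_mul_cancel₀ h0.ne', one_smul,
            add_sub_cancel]
        exact (convex_segment u v).segment_subset hz hq
          (mem_segment_of_mem_rayFrom hqz this (hy hqz).le)
    filter_upwards [hev u, hev v] with y hyu hyv hy w hw hwS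
    apply hy
    rcases segment_subset_union_of_mem hz hwS with h | h
    · exact key u (left_mem_segment ℝ u v) y hyu w h hw
    · exact key v (right_mem_segment ℝ u v) y hyv w h hw
  · have hcl : IsClosed (segment ℝ u v) := (isCompact_segment u v).isClosed
    obtain ⟨r, hr, hball⟩ := Metric.isOpen_iff.1 hcl.isOpen_compl z hz
    filter_upwards [Metric.ball_mem_nhds z hr] with y hy _
    exact (openSegment_subset_segment ℝ z y).trans
      (((convex_ball z r).segment_subset (Metric.mem_ball_self hr) hy).trans hball)

theorem LocallyRadial.biUnion {ι : Type*} {I : Set ι} (hI : I.Finite) {S : ι → Set E}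
    (h : ∀ i ∈ I, LocallyRadial (S i)) : LocallyRadial (⋃ i ∈ I, S i) := by
  intro z
  have := (hI.eventually_all (l := 𝓝 z) (p := fun i y => y ∉ S i → openSegment ℝ z y ⊆ (S i)ᶜ)).2
    fun i hi => h i hi z
  filter_upwards [this] with y hy hyD w hw hwD
  simp only [mem_iUnion, exists_prop, not_exists, not_and] at hwD hyD
  obtain ⟨i, hi, hwi⟩ := hwD
  exact hy i hi (hyD i hi) hw hwi

theorem LocallyRadial.union {S T : Set E} (hS : LocallyRadial S) (hT : LocallyRadial T) :
    LocallyRadial (S ∪ T) := by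
  intro z
  filter_upwards [hS z, hT z] with y hy hy' hyD w hw hwD
  rw [mem_union, not_or] at hyD
  exact hwD.elim (hy hyD.1 hw) (hy' hyD.2 hw)

theorem locallyRadial_singleton (p : E) : LocallyRadial ({p} : Set E) := by
  simpa using locallyRadial_segment p p

/-! ### Faces of the complement of a closed set -/

theorem isOpen_connectedComponentIn_compl {D : Set E} (hD : IsClosed D) (y : E) :
    IsOpen (connectedComponentIn Dᶜ y) :=
  hD.isOpen_compl.connectedComponentIn

theorem connectedComponentIn_compl_eq_of_mem_closure {D : Set E} (hD : IsClosed D) {y z : E}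
    (hz : z ∈ closure (connectedComponentIn Dᶜ y)) (hzD : z ∉ D) :
    connectedComponentIn Dᶜ z = connectedComponentIn Dᶜ y := by
  obtain ⟨w, hw, hw'⟩ := mem_closure_iff.1 hz _ (isOpen_connectedComponentIn_compl hD z)
    (mem_connectedComponentIn hzD)
  rw [connectedComponentIn_eq hw, connectedComponentIn_eq hw']

theorem mem_closure_connectedComponentIn_of_openSegment {D : Set E} {z y : E} (hy : y ∉ D)
    (h : openSegment ℝ z y ⊆ Dᶜ) : z ∈ closure (connectedComponentIn Dᶜ y) ∧
      openSegment ℝ z y ⊆ connectedComponentIn Dᶜ y := by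
  have hins : insert y (openSegment ℝ z y) ⊆ Dᶜ := insert_subset hy h
  have hsub : insert y (openSegment ℝ z y) ⊆ closure (openSegment ℝ z y) := by
    refine insert_subset ?_ subset_closure
    exact segment_subset_closure_openSegment (right_mem_segment ℝ z y)
  have hpre : IsPreconnected (insert y (openSegment ℝ z y)) :=
    (convex_openSegment z y).isPreconnected.subset_closure (subset_insert _ _) hsub
  have hF := hpre.subset_connectedComponentIn (mem_insert _ _) hins
  have hF' : openSegment ℝ z y ⊆ connectedComponentIn Dᶜ y := (subset_insert _ _).trans hF
  exact ⟨closure_mono hF' (segment_subset_closure_openSegment (left_mem_segment ℝ z y)), hF'⟩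

/-- Otherwise the closure of the face would add no point of U to the face, and the face and the
complement of its closure would disconnect U. -/
theorem closure_connectedComponentIn_compl_inter_nonempty {D U : Set E} (hD : IsClosed D)
    (hU : IsPreconnected U) {y : E} (hF : (U ∩ connectedComponentIn Dᶜ y).Nonempty)
    (hUD : (U ∩ D).Nonempty) : (U ∩ (D ∩ closure (connectedComponentIn Dᶜ y))).Nonempty := by
  by_contra hne
  have hne' : ∀ z ∈ U, z ∈ D → z ∉ closure (connectedComponentIn Dᶜ y) :=
    fun z hz hzD hzF => hne ⟨z, hz, hzD, hzF⟩
  obtain ⟨z, hz, hzD⟩ := hUD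
  obtain ⟨w, -, hw, hw'⟩ := hU _ _ (isOpen_connectedComponentIn_compl hD y)
    (isClosed_closure (s := connectedComponentIn Dᶜ y)).isOpen_compl
    (fun x hx => by
      by_cases hxF : x ∈ closure (connectedComponentIn Dᶜ y)
      · left
        have hxD : x ∉ D := fun h => hne' x hx h hxF
        rw [← connectedComponentIn_compl_eq_of_mem_closure hD hxF hxD]
        exact mem_connectedComponentIn hxD
      · exact Or.inr hxF)
    hF ⟨z, hz, hne' z hz hzD⟩
  exact hw' (subset_closure hw)

/-- If no face touches both, U splits into two open parts: X with the faces touching X inside U, and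
Y with the remaining faces. Openness at points of D is where radiality enters: every face close to
such a point touches it. -/
theorem exists_component_closure_meets_both {D U X Y : Set E} (hD : IsClosed D)
    (hrad : LocallyRadial D) (hUo : IsOpen U) (hU : IsPreconnected U) (hX : IsClosed X)
    (hY : IsClosed Y) (hXD : X ⊆ D) (hYD : Y ⊆ D) (hcov : U ∩ D ⊆ X ∪ Y)
    (hdisj : ∀ x ∈ U, x ∈ X → x ∉ Y) (hXU : (U ∩ X).Nonempty) (hYU : (U ∩ Y).Nonempty) :
    ∃ y, y ∉ D ∧ (U ∩ X ∩ closure (connectedComponentIn Dᶜ y)).Nonempty ∧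
      (U ∩ Y ∩ closure (connectedComponentIn Dᶜ y)).Nonempty := by
  by_contra! hcon
  let T : Set E := {y | y ∉ D ∧ (U ∩ X ∩ closure (connectedComponentIn Dᶜ y)).Nonempty}
  have hcomp : ∀ y, y ∉ D → ∀ᶠ x in 𝓝 y, x ∉ D ∧
      connectedComponentIn Dᶜ x = connectedComponentIn Dᶜ y := by
    intro y hy
    filter_upwards [(isOpen_connectedComponentIn_compl hD y).mem_nhds
      (mem_connectedComponentIn hy)] with x hx
    exact ⟨connectedComponentIn_subset _ _ hx, (connectedComponentIn_eq hx).symm⟩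
  have hA : IsOpen (U ∩ (X ∪ T)) := by
    rw [isOpen_iff_mem_nhds]
    rintro z ⟨hzU, hz⟩
    refine inter_mem (hUo.mem_nhds hzU) ?_
    rcases hz with hz | ⟨hzD, hzT⟩
    · filter_upwards [hrad z, hY.isOpen_compl.mem_nhds (hdisj z hzU hz), hUo.mem_nhds hzU]
        with x hx hxY hxU
      by_cases hxD : x ∈ D
      · exact (hcov ⟨hxU, hxD⟩).elim Or.inl fun h => absurd h hxY
      · exact Or.inr ⟨hxD, z, ⟨hzU, hz⟩,
          (mem_closure_connectedComponentIn_of_openSegment hxD (hx hxD)).1⟩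
    · filter_upwards [hcomp z hzD] with x hx
      exact Or.inr ⟨hx.1, by rwa [hx.2]⟩
  have hB : IsOpen (U ∩ (Y ∪ (D ∪ T)ᶜ)) := by
    rw [isOpen_iff_mem_nhds]
    rintro z ⟨hzU, hz⟩
    refine inter_mem (hUo.mem_nhds hzU) ?_
    rcases hz with hz | hz
    · filter_upwards [hrad z, hX.isOpen_compl.mem_nhds fun h => hdisj z hzU h hz,
        hUo.mem_nhds hzU] with x hx hxX hxU
      by_cases hxD : x ∈ D
      · exact (hcov ⟨hxU, hxD⟩).elim (fun h => absurd h hxX) Or.inl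
      · right
        rintro (h | ⟨-, h⟩)
        · exact hxD h
        · have := (mem_closure_connectedComponentIn_of_openSegment hxD (hx hxD)).1
          exact (hcon x hxD h).subset ⟨⟨hzU, hz⟩, this⟩
    · rw [compl_union] at hz
      filter_upwards [hcomp z hz.1] with x hx
      right
      rintro (h | ⟨-, h⟩)
      · exact hx.1 h
      · exact hz.2 ⟨hz.1, by rwa [← hx.2]⟩
  obtain ⟨x, hx, ⟨-, hx1⟩, -, hx2⟩ := hU _ _ hA hB
    (fun x hx => by
      by_cases hxD : x ∈ D
      · exact (hcov ⟨hx, hxD⟩).imp (fun h => ⟨hx, Or.inl h⟩) fun h => ⟨hx, Or.inl h⟩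
      · by_cases hxT : x ∈ T
        · exact Or.inl ⟨hx, Or.inr hxT⟩
        · exact Or.inr ⟨hx, Or.inr fun h => h.elim hxD hxT⟩)
    (hXU.imp fun x hx => ⟨hx.1, hx.1, Or.inl hx.2⟩)
    (hYU.imp fun x hx => ⟨hx.1, hx.1, Or.inl hx.2⟩)
  rcases hx1 with h1 | h1 <;> rcases hx2 with h2 | h2
  · exact hdisj x hx h1 h2
  · exact h2 (Or.inl (hXD h1))
  · exact h1.1 (hYD h2)
  · exact h2 (Or.inr h1)

/-- Slitting a small ball along the second ray leaves it connected. The slit ball meets both the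
face and D, hence meets D at a point of the face's closure, and only the first ray remains there. -/
theorem exists_mem_closure_component_along_ray {D : Set E} (hD : IsClosed D) {z y₁ y₂ y : E}
    (h₁ : y₁ ≠ z) (h₂ : y₂ ≠ z) (hdisj : ∀ w ∈ segment ℝ z y₁, w ∈ segment ℝ z y₂ → w = z)
    (hs₁ : segment ℝ z y₁ ⊆ D) (hs₂ : segment ℝ z y₂ ⊆ D)
    (hloc : ∀ᶠ w in 𝓝 z, w ∈ D → w ∈ segment ℝ z y₁ ∪ segment ℝ z y₂)
    (hz : z ∈ closure (connectedComponentIn Dᶜ y)) {ε : ℝ} (hε : 0 < ε) :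
    ∃ t : ℝ, 0 < t ∧ t ≤ ε ∧ z + t • (y₁ - z) ∈ closure (connectedComponentIn Dᶜ y) := by
  obtain ⟨r₀, hr₀, hball⟩ := Metric.eventually_nhds_iff_ball.1 hloc
  have hn₁ : 0 < dist y₁ z := dist_pos.2 h₁
  have hn₂ : 0 < dist y₂ z := dist_pos.2 h₂
  obtain ⟨r, hr, hrr⟩ := exists_between
    (lt_min hr₀ (lt_min (mul_pos hε hn₁) (lt_min hn₁ hn₂)))
  obtain ⟨hr1, hr2, hr3, hr4⟩ : r < r₀ ∧ r < ε * dist y₁ z ∧ r < dist y₁ z ∧ r < dist y₂ z := by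
    simpa using hrr
  have hdist : ∀ t : ℝ, 0 ≤ t → dist (z + t • (y₁ - z)) z = t * dist y₁ z := by
    intro t ht
    rw [dist_eq_norm, dist_eq_norm, add_sub_cancel_left, norm_smul, Real.norm_of_nonneg ht]
  obtain ⟨w, ⟨hwb, hwr⟩, hwD, hwF⟩ := closure_connectedComponentIn_compl_inter_nonempty hD
    (isPreconnected_ball_diff_rayFrom h₂ hr) (y := y)
    (by
      obtain ⟨x, hx, hxF⟩ := mem_closure_iff.1 hz _ Metric.isOpen_ball (Metric.mem_ball_self hr)
      refine ⟨x, ⟨hx, fun hray => connectedComponentIn_subset _ _ hxF (hs₂ ?_)⟩, hxF⟩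
      exact mem_segment_of_mem_rayFrom h₂ hray ((Metric.mem_ball.1 hx).le.trans hr4.le))
    (by
      have ht : 0 < r / (2 * dist y₁ z) := by positivity
      refine ⟨z + (r / (2 * dist y₁ z)) • (y₁ - z),
        ⟨?_, notMem_rayFrom_of_segment_inter hdisj h₁ ht⟩, hs₁ ?_⟩
      · rw [Metric.mem_ball, hdist _ ht.le]
        field_simp
        linarith
      · refine mem_segment_iff_add_smul.2 ⟨_, ht.le, ?_, rfl⟩
        rw [div_le_one (by positivity)]
        linarith)
  rcases hball w (Metric.ball_subset_ball hr1.le hwb) hwD with h | h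
  · obtain ⟨t, ht0, ht1, rfl⟩ := mem_segment_iff_add_smul.1 h
    refine ⟨t, ht0.lt_of_ne ?_, ?_, hwF⟩
    · rintro rfl
      exact hwr (by simpa using self_mem_rayFrom z y₂)
    · rw [Metric.mem_ball, hdist t ht0] at hwb
      exact (lt_of_mul_lt_mul_right (hwb.trans hr2) hn₁.le).le
  · exact absurd (segment_subset_rayFrom z y₂ h) hwr

end Plane

/-! ### Polygonal arcs -/

section Arc

variable {p q : Plane} {s : Set Plane}

theorem isPolygonalArc_segment (h : p ≠ q) : IsPolygonalArc p q (segment ℝ p q) := by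
  refine ⟨1, fun j => if j = 0 then p else q, one_pos, by simp, by simp, ?_, ?_, ?_⟩
  · intro i hi j hj hij
    simp only [mem_Iic] at hi hj
    interval_cases i <;> interval_cases j <;> simp_all
  · intro i j hij hj
    omega
  · ext x
    simp

theorem IsPolygonalArc.isCompact (h : IsPolygonalArc p q s) : IsCompact s := by
  obtain ⟨n, c, -, -, -, -, -, rfl⟩ := h
  exact (finite_Iio n).isCompact_biUnion fun i _ => isCompact_segment _ _

theorem IsPolygonalArc.locallyRadial (h : IsPolygonalArc p q s) : LocallyRadial s := by
  obtain ⟨n, c, -, -, -, -, -, rfl⟩ := h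
  exact LocallyRadial.biUnion (finite_Iio n) fun i _ => locallyRadial_segment _ _

theorem IsPolygonalArc.left_mem (h : IsPolygonalArc p q s) : p ∈ s := by
  obtain ⟨n, c, hn, rfl, -, -, -, rfl⟩ := h
  exact mem_biUnion (mem_Iio.2 hn) (left_mem_segment ℝ _ _)

theorem IsPolygonalArc.symm (h : IsPolygonalArc p q s) : IsPolygonalArc q p s := by
  obtain ⟨n, c, hn, rfl, rfl, hinj, hint, rfl⟩ := h
  have hstep : ∀ i < n, segment ℝ (c (n - i)) (c (n - (i + 1))) =
      segment ℝ (c (n - (i + 1))) (c (n - (i + 1) + 1)) := by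
    intro i hi
    rw [segment_symm, show n - (i + 1) + 1 = n - i by omega]
  refine ⟨n, fun j => c (n - j), hn, by simp, by simp, ?_, ?_, ?_⟩
  · intro i hi j hj hij
    simp only [mem_Iic] at hi hj
    have := hinj (mem_Iic.2 (by omega : n - i ≤ n)) (mem_Iic.2 (by omega : n - j ≤ n)) hij
    omega
  · intro i j hij hj x hx hx'
    simp only [hstep i (by omega), hstep j hj] at hx hx'
    obtain ⟨h1, h2⟩ := hint (n - (j + 1)) (n - (i + 1)) (by omega) (by omega) x hx' hx
    have hji : j = i + 1 := by omega
    exact ⟨hji, by rw [h2, hji]⟩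
  · ext x
    simp only [mem_iUnion, mem_Iio, exists_prop]
    constructor
    · rintro ⟨i, hi, hx⟩
      refine ⟨n - (i + 1), by omega, ?_⟩
      rw [hstep _ (by omega), show n - (n - (i + 1) + 1) = i by omega]
      exact hx
    · rintro ⟨i, hi, hx⟩
      rw [hstep i hi] at hx
      exact ⟨n - (i + 1), by omega, hx⟩

theorem IsPolygonalArc.right_mem (h : IsPolygonalArc p q s) : q ∈ s := h.symm.left_mem

theorem eventually_notMem_segments {n : ℕ} {c : ℕ → Plane} {z : Plane} {P : ℕ → Prop}
    (h : ∀ j < n, P j → z ∉ segment ℝ (c j) (c (j + 1))) :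
    ∀ᶠ w in 𝓝 z, ∀ j < n, P j → w ∉ segment ℝ (c j) (c (j + 1)) := by
  refine ((finite_Iio n).eventually_all (l := 𝓝 z)
    (p := fun j w => P j → w ∉ segment ℝ (c j) (c (j + 1)))).2 fun j hj => ?_
  by_cases hP : P j
  · filter_upwards [(isCompact_segment (c j) (c (j + 1))).isClosed.isOpen_compl.mem_nhds
      (h j hj hP)] with w hw _ using hw
  · exact Eventually.of_forall fun _ h => absurd h hP

/-- Close to its first point, a polygonal arc is a straight segment. -/
theorem IsPolygonalArc.exists_initial_segment (h : IsPolygonalArc p q s) :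
    ∃ y, y ≠ p ∧ segment ℝ p y ⊆ s ∧ ∀ᶠ w in 𝓝 p, w ∈ s → w ∈ segment ℝ p y := by
  obtain ⟨n, c, hn, rfl, rfl, hinj, hint, rfl⟩ := h
  refine ⟨c 1, fun e => ?_, subset_biUnion_of_mem (u := fun i => segment ℝ (c i) (c (i + 1)))
    (mem_Iio.2 hn), ?_⟩
  · have := hinj (mem_Iic.2 hn) (mem_Iic.2 hn.le) e
    omega
  · have := eventually_notMem_segments (n := n) (c := c) (z := c 0) (P := fun j => j ≠ 0) (by
      intro j hj hj0 hz
      obtain ⟨-, h2⟩ := hint 0 j (by omega) hj _ (left_mem_segment ℝ _ _) hz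
      exact hj0 (hinj (mem_Iic.2 hj.le) (mem_Iic.2 hn.le) h2.symm))
    filter_upwards [this] with w hw hws
    simp only [mem_iUnion, mem_Iio, exists_prop] at hws
    obtain ⟨j, hj, hwj⟩ := hws
    by_cases hj0 : j = 0
    · subst hj0
      exact hwj
    · exact absurd hwj (hw j hj hj0)

/-- Away from its ends the arc looks like two segments at z. One goes forward to the next corner;
the other goes back to c i, or to the preceding corner when z = c i. -/
theorem exists_local_rays {n : ℕ} {c : ℕ → Plane} (hinj : InjOn c (Iic n))
    (hint : ∀ i j : ℕ, i < j → j < n → ∀ x : Plane, x ∈ segment ℝ (c i) (c (i + 1)) →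
      x ∈ segment ℝ (c j) (c (j + 1)) → j = i + 1 ∧ x = c j) {i : ℕ} (hi : i < n) {z : Plane}
    (hz : z ∈ segment ℝ (c i) (c (i + 1))) (hz1 : z ≠ c (i + 1)) (hz0 : z ≠ c 0) :
    ∃ y, y ≠ z ∧ segment ℝ z y ⊆ (⋃ i ∈ Iio n, segment ℝ (c i) (c (i + 1))) ∧
      (∀ w ∈ segment ℝ z (c (i + 1)), w ∈ segment ℝ z y → w = z) ∧
      ∀ᶠ w in 𝓝 z, w ∈ (⋃ i ∈ Iio n, segment ℝ (c i) (c (i + 1))) →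
        w ∈ segment ℝ z (c (i + 1)) ∪ segment ℝ z y := by
  have hsub : ∀ j < n, segment ℝ (c j) (c (j + 1)) ⊆
      ⋃ i ∈ Iio n, segment ℝ (c i) (c (i + 1)) := fun j hj =>
    subset_biUnion_of_mem (u := fun i => segment ℝ (c i) (c (i + 1))) (mem_Iio.2 hj)
  by_cases hzi : z = c i
  · obtain ⟨m, rfl⟩ : ∃ m, i = m + 1 := by
      cases i with
      | zero => exact absurd hzi hz0
      | succ m => exact ⟨m, rfl⟩
    subst hzi
    refine ⟨c m, fun e => ?_, ?_, ?_, ?_⟩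
    · have := hinj (mem_Iic.2 (by omega)) (mem_Iic.2 hi.le) e
      omega
    · rw [segment_symm]
      exact hsub m (by omega)
    · intro w hw hw'
      rw [segment_symm] at hw'
      exact (hint m (m + 1) (by omega) hi w hw' hw).2
    · have := eventually_notMem_segments (n := n) (c := c) (z := c (m + 1))
        (P := fun j => j ≠ m ∧ j ≠ m + 1) (by
          rintro j hj ⟨hjm, hjm'⟩ hzj
          rcases lt_or_gt_of_ne hjm' with h | h
          · exact hjm (by have := (hint j (m + 1) h hi _ hzj hz).1; omega)
          · obtain ⟨h1, h2⟩ := hint (m + 1) j h hj _ hz hzj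
            exact hz1 (by rw [h2, h1]))
      filter_upwards [this] with w hw hws
      simp only [mem_iUnion, mem_Iio, exists_prop] at hws
      obtain ⟨j, hj, hwj⟩ := hws
      by_cases hjm : j = m
      · subst hjm
        right
        rwa [segment_symm]
      · by_cases hjm' : j = m + 1
        · subst hjm'
          exact Or.inl hwj
        · exact absurd hwj (hw j hj ⟨hjm, hjm'⟩)
  · refine ⟨c i, Ne.symm hzi, ?_, fun w hw hw' => eq_of_mem_segment_of_mem_segment hz hw' hw, ?_⟩
    · exact ((convex_segment _ _).segment_subset hz (left_mem_segment ℝ _ _)).trans (hsub i hi)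
    · have := eventually_notMem_segments (n := n) (c := c) (z := z)
        (P := fun j => j ≠ i) (by
          rintro j hj hji hzj
          rcases lt_or_gt_of_ne hji with h | h
          · exact hzi (hint j i h hi _ hzj hz).2
          · obtain ⟨h1, h2⟩ := hint i j h hj _ hz hzj
            exact hz1 (by rw [h2, h1]))
      filter_upwards [this] with w hw hws
      simp only [mem_iUnion, mem_Iio, exists_prop] at hws
      obtain ⟨j, hj, hwj⟩ := hws
      by_cases hji : j = i
      · subst hji
        exact (segment_subset_union_of_mem hz hwj).symm
      · exact absurd hwj (hw j hj hji)

/-- A face of the complement of `D` which touches an arc of `D`, away from its first point,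
touches the last point of this arc. -/
theorem IsPolygonalArc.right_mem_closure_component {D : Set Plane} (hD : IsClosed D)
    (h : IsPolygonalArc p q s) (hs : s ⊆ D)
    (hloc : ∀ z ∈ s, z ≠ p → z ≠ q → ∀ᶠ w in 𝓝 z, w ∈ D → w ∈ s) {x y : Plane} (hxs : x ∈ s)
    (hxp : x ≠ p) (hx : x ∈ closure (connectedComponentIn Dᶜ y)) :
    q ∈ closure (connectedComponentIn Dᶜ y) := by
  obtain ⟨n, c, hn, rfl, rfl, hinj, hint, rfl⟩ := h
  have hsub : ∀ j < n, segment ℝ (c j) (c (j + 1)) ⊆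
      ⋃ i ∈ Iio n, segment ℝ (c i) (c (i + 1)) := fun j hj =>
    subset_biUnion_of_mem (u := fun i => segment ℝ (c i) (c (i + 1))) (mem_Iio.2 hj)
  have hstep : ∀ i < n, ∀ z ∈ segment ℝ (c i) (c (i + 1)), z ≠ c 0 →
      z ∈ closure (connectedComponentIn Dᶜ y) →
      c (i + 1) ∈ closure (connectedComponentIn Dᶜ y) := by
    intro i hi z hz hz0 hzF
    have hci : c (i + 1) - c i ≠ 0 := by
      intro e
      have := hinj (mem_Iic.2 (by omega : i + 1 ≤ n)) (mem_Iic.2 hi.le) (sub_eq_zero.1 e)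
      omega
    obtain ⟨a, ha0, ha1, rfl⟩ := mem_segment_iff_add_smul.1 hz
    have hcl : IsClosed {t : ℝ | c i + t • (c (i + 1) - c i) ∈
        closure (connectedComponentIn Dᶜ y)} :=
      isClosed_closure.preimage (by fun_prop : Continuous fun t : ℝ =>
        c i + t • (c (i + 1) - c i))
    -- Continuous induction along the segment: the parameters touching the face form a closed set,
    -- and from each t < 1 the ray lemma provides a slightly larger one.
    have key := (hcl.inter isClosed_Icc).Icc_subset_of_forall_exists_gt (a := a) (b := 1) hzF (by
      rintro t ⟨htF, hta, ht1⟩ u hu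
      have hw : c i + t • (c (i + 1) - c i) ∈ segment ℝ (c i) (c (i + 1)) :=
        mem_segment_iff_add_smul.2 ⟨t, ha0.trans hta, ht1.le, rfl⟩
      have hw1 : c i + t • (c (i + 1) - c i) ≠ c (i + 1) := by
        intro e
        have e' : (1 - t) • (c (i + 1) - c i) = 0 := by
          have : (1 - t) • (c (i + 1) - c i) = c (i + 1) - (c i + t • (c (i + 1) - c i)) := by
            module
          rw [this, e, sub_self]
        rcases smul_eq_zero.1 e' with h | h
        · linarith
        · exact hci h
      have hw0 : c i + t • (c (i + 1) - c i) ≠ c 0 := by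
        intro e
        rcases Nat.eq_zero_or_pos i with rfl | hpos
        · rw [add_eq_left, smul_eq_zero] at e
          rcases e with rfl | e
          · obtain rfl : a = 0 := le_antisymm hta ha0
            exact hz0 (by simp)
          · exact hci e
        · rw [e] at hw
          have h2 := (hint 0 i hpos hi _ (left_mem_segment ℝ _ _) hw).2
          have := hinj (mem_Iic.2 (Nat.zero_le n)) (mem_Iic.2 hi.le) h2
          omega
      have hwn : c i + t • (c (i + 1) - c i) ≠ c n := by
        intro e
        obtain ⟨m, rfl⟩ : ∃ m, n = m + 1 := ⟨n - 1, by omega⟩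
        rcases (Nat.lt_succ_iff.1 hi).eq_or_lt with rfl | hlt
        · exact hw1 e
        · rw [e] at hw
          have h2 := (hint i m hlt (by omega) _ hw (right_mem_segment ℝ _ _)).2
          have := hinj (mem_Iic.2 le_rfl) (mem_Iic.2 (Nat.le_succ m)) h2
          omega
      obtain ⟨y₂, hy₂, hs₂, hdisj, hlo⟩ := exists_local_rays hinj hint hi hw hw1 hw0
      have hut : 0 < u - t := sub_pos.2 hu
      obtain ⟨τ, hτ0, hτ1, hτF⟩ := exists_mem_closure_component_along_ray hD hw1.symm hy₂ hdisj
        (((convex_segment _ _).segment_subset hw (right_mem_segment ℝ _ _)).trans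
          ((hsub i hi).trans hs)) (hs₂.trans hs)
        (by
          filter_upwards [hlo, hloc _ (hsub i hi hw) hw0 hwn] with w h1 h2 h3 using h1 (h2 h3))
        htF hut
      -- Going the fraction τ of the remaining way to c (i + 1) moves the parameter by τ(1 - t),
      -- which is at most u - t.
      refine ⟨t + τ * (1 - t), ?_, ?_, ?_⟩
      · have : c i + (t + τ * (1 - t)) • (c (i + 1) - c i) = c i + t • (c (i + 1) - c i) +
            τ • (c (i + 1) - (c i + t • (c (i + 1) - c i))) := by module
        rw [mem_ofPred_eq, this]
        exact hτF
      · have := mul_pos hτ0 (sub_pos.2 ht1)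
        linarith
      · have : τ * (1 - t) ≤ τ := mul_le_of_le_one_right hτ0.le (by linarith)
        linarith)
    have := key (right_mem_Icc.2 ha1)
    simpa using this
  simp only [mem_iUnion, mem_Iio, exists_prop] at hxs
  obtain ⟨i, hi, hxi⟩ := hxs
  have hall : ∀ k, i + 1 ≤ k → k ≤ n → c k ∈ closure (connectedComponentIn Dᶜ y) := by
    intro k hk
    induction k, hk using Nat.le_induction with
    | base => intro _; exact hstep i hi x hxi hxp hx
    | succ k hk ih =>
      intro hkn
      refine hstep k (by omega) (c k) (left_mem_segment ℝ _ _) (fun e => ?_) (ih (by omega))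
      have := hinj (mem_Iic.2 (by omega : k ≤ n)) (mem_Iic.2 (Nat.zero_le n)) e
      omega
  exact hall n hi le_rfl

/-! ### Cutting, extending and routing arcs -/

theorem IsPolygonalArc.exists_subarc (h : IsPolygonalArc p q s) {z : Plane} (hz : z ∈ s)
    (hzp : z ≠ p) : ∃ s' ⊆ s, IsPolygonalArc p z s' := by
  classical
  obtain ⟨n, c, hn, rfl, rfl, hinj, hint, rfl⟩ := h
  have hex : ∃ i, i < n ∧ z ∈ segment ℝ (c i) (c (i + 1)) := by simpa using hz
  -- Cutting on the first segment through z ensures that z is none of the corners kept.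
  obtain ⟨i, ⟨hi, hzi⟩, hmin⟩ : ∃ i, (i < n ∧ z ∈ segment ℝ (c i) (c (i + 1))) ∧
      ∀ j < i, ¬ (j < n ∧ z ∈ segment ℝ (c j) (c (j + 1))) :=
    ⟨Nat.find hex, Nat.find_spec hex, fun j hj => Nat.find_min hex hj⟩
  have hzc : ∀ j ≤ i, c j ≠ z := by
    rintro j hj rfl
    rcases Nat.eq_zero_or_pos j with rfl | hpos
    · exact hzp rfl
    · obtain ⟨m, rfl⟩ : ∃ m, j = m + 1 := ⟨j - 1, by omega⟩
      exact hmin m (by omega) ⟨by omega, right_mem_segment ℝ _ _⟩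
  set c' : ℕ → Plane := fun j => if j ≤ i then c j else z with hc'
  have hc1 : ∀ j ≤ i, c' j = c j := fun j hj => by simp [hc', hj]
  have hc2 : c' (i + 1) = z := by simp [hc']
  have hseg : ∀ j ≤ i, segment ℝ (c' j) (c' (j + 1)) ⊆ segment ℝ (c j) (c (j + 1)) := by
    intro j hj
    rcases hj.eq_or_lt with rfl | hlt
    · rw [hc1 j le_rfl, hc2]
      exact (convex_segment _ _).segment_subset (left_mem_segment ℝ _ _) hzi
    · rw [hc1 j hj, hc1 (j + 1) hlt]
  refine ⟨⋃ j ∈ Iio (i + 1), segment ℝ (c' j) (c' (j + 1)), ?_, i + 1, c', Nat.succ_pos i,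
    hc1 0 (Nat.zero_le i), hc2, ?_, ?_, rfl⟩
  · refine iUnion₂_subset fun j hj => ?_
    have hj' : j ≤ i := Nat.lt_succ_iff.1 hj
    exact (hseg j hj').trans (subset_biUnion_of_mem
      (u := fun i => segment ℝ (c i) (c (i + 1))) (mem_Iio.2 (by omega)))
  · intro j hj k hk e
    simp only [mem_Iic] at hj hk
    rcases hj.eq_or_lt with rfl | hj <;> rcases hk.eq_or_lt with rfl | hk
    · rfl
    · rw [hc2, hc1 k (by omega)] at e
      exact absurd e.symm (hzc k (by omega))
    · rw [hc2, hc1 j (by omega)] at e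
      exact absurd e (hzc j (by omega))
    · rw [hc1 j (by omega), hc1 k (by omega)] at e
      exact hinj (mem_Iic.2 (by omega)) (mem_Iic.2 (by omega)) e
  · intro j k hjk hk x hx hx'
    rw [hc1 k (by omega)]
    exact hint j k hjk (by omega) x (hseg j (by omega) hx) (hseg k (by omega) hx')

theorem IsPolygonalArc.append_segment (h : IsPolygonalArc p q s) {z : Plane} (hzq : z ≠ q)
    (hs : ∀ x ∈ segment ℝ q z, x ∈ s → x = q) : IsPolygonalArc p z (s ∪ segment ℝ q z) := by
  obtain ⟨n, c, hn, rfl, rfl, hinj, hint, rfl⟩ := h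
  have hsub : ∀ j < n, segment ℝ (c j) (c (j + 1)) ⊆
      ⋃ i ∈ Iio n, segment ℝ (c i) (c (i + 1)) := fun j hj =>
    subset_biUnion_of_mem (u := fun i => segment ℝ (c i) (c (i + 1))) (mem_Iio.2 hj)
  obtain ⟨m, rfl⟩ : ∃ m, n = m + 1 := ⟨n - 1, by omega⟩
  have hzc : ∀ j ≤ m + 1, c j ≠ z := by
    rintro j hj rfl
    refine hzq (hs _ (right_mem_segment ℝ _ _) ?_)
    rcases hj.eq_or_lt with rfl | hj
    · exact absurd rfl hzq
    · exact hsub j hj (left_mem_segment ℝ _ _)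
  set c' : ℕ → Plane := fun j => if j ≤ m + 1 then c j else z with hc'
  have hc1 : ∀ j ≤ m + 1, c' j = c j := fun j hj => by simp [hc', hj]
  have hc2 : c' (m + 1 + 1) = z := by simp [hc']
  refine ⟨m + 1 + 1, c', Nat.succ_pos _, hc1 0 (Nat.zero_le _), hc2, ?_, ?_, ?_⟩
  · intro j hj k hk e
    simp only [mem_Iic] at hj hk
    rcases hj.eq_or_lt with rfl | hj <;> rcases hk.eq_or_lt with rfl | hk
    · rfl
    · rw [hc2, hc1 k (by omega)] at e
      exact absurd e.symm (hzc k (by omega))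
    · rw [hc2, hc1 j (by omega)] at e
      exact absurd e (hzc j (by omega))
    · rw [hc1 j (by omega), hc1 k (by omega)] at e
      exact hinj (mem_Iic.2 (by omega)) (mem_Iic.2 (by omega)) e
  · intro j k hjk hk x hx hx'
    rw [hc1 j (by omega), hc1 (j + 1) (by omega)] at hx
    rcases (Nat.lt_succ_iff.1 hk).eq_or_lt with rfl | hk
    · rw [hc1 _ le_rfl, hc2] at hx'
      rw [hc1 _ le_rfl]
      have hxq := hs x hx' (hsub j (by omega) hx)
      refine ⟨?_, hxq⟩
      rcases (Nat.lt_succ_iff.1 hjk).eq_or_lt with rfl | hlt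
      · rfl
      · rw [hxq] at hx
        have h2 := (hint j m hlt (by omega) _ hx (right_mem_segment ℝ _ _)).2
        have := hinj (mem_Iic.2 le_rfl) (mem_Iic.2 (Nat.le_succ m)) h2
        omega
    · rw [hc1 k (by omega), hc1 (k + 1) (by omega)] at hx'
      rw [hc1 k (by omega)]
      exact hint j k hjk hk x hx hx'
  · ext x
    simp only [mem_union, mem_iUnion, mem_Iio, exists_prop]
    constructor
    · rintro (⟨j, hj, hx⟩ | hx)
      · refine ⟨j, by omega, ?_⟩
        rwa [hc1 j (by omega), hc1 (j + 1) (by omega)]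
      · refine ⟨m + 1, by omega, ?_⟩
        rwa [hc1 _ le_rfl, hc2]
    · rintro ⟨j, hj, hx⟩
      rcases (Nat.lt_succ_iff.1 hj).eq_or_lt with rfl | hj
      · rw [hc1 _ le_rfl, hc2] at hx
        exact Or.inr hx
      · rw [hc1 j (by omega), hc1 (j + 1) (by omega)] at hx
        exact Or.inl ⟨j, hj, hx⟩

theorem IsPolygonalArc.exists_extend (h : IsPolygonalArc p q s) {r : Plane} (hr : r ≠ p) :
    ∃ s' ⊆ s ∪ segment ℝ q r, IsPolygonalArc p r s' := by
  -- Leave the arc at its point of [q, r] nearest to r: beyond it, the segment to r never meets the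
  -- arc again.
  obtain ⟨z, ⟨hzs, hzq⟩, hmin⟩ := (h.isCompact.inter (isCompact_segment q r)).exists_isMinOn
    ⟨q, h.right_mem, left_mem_segment ℝ q r⟩ (f := fun x => dist x r) (by fun_prop)
  have hzr : segment ℝ z r ⊆ segment ℝ q r :=
    (convex_segment q r).segment_subset hzq (right_mem_segment ℝ q r)
  by_cases hzp : z = p
  · subst hzp
    exact ⟨segment ℝ z r, hzr.trans subset_union_right, isPolygonalArc_segment hr.symm⟩
  obtain ⟨s₁, hs₁, harc⟩ := h.exists_subarc hzs hzp
  by_cases hzr' : r = z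
  · subst hzr'
    exact ⟨s₁, hs₁.trans subset_union_left, harc⟩
  refine ⟨s₁ ∪ segment ℝ z r, union_subset_union hs₁ hzr, harc.append_segment hzr' ?_⟩
  intro x hx hxs
  have hle : dist z r ≤ dist x r := hmin ⟨hs₁ hxs, hzr hx⟩
  obtain ⟨t, ht0, ht1, rfl⟩ := mem_segment_iff_add_smul.1 hx
  have e : z + t • (r - z) - r = (1 - t) • (z - r) := by module
  rw [dist_eq_norm, dist_eq_norm, e, norm_smul, Real.norm_of_nonneg (by linarith)] at hle
  have hpos : 0 < ‖z - r‖ := norm_pos_iff.2 (sub_ne_zero.2 (Ne.symm hzr'))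
  have : t = 0 := by
    by_contra hne
    have : 0 < t := lt_of_le_of_ne ht0 (Ne.symm hne)
    nlinarith
  rw [this, zero_smul, add_zero]

theorem IsPolygonalArc.exists_of_isPreconnected {F : Set Plane} (hF : IsOpen F)
    (hFc : IsPreconnected F) (hp : p ∉ F) (h : IsPolygonalArc p q s) (hs : s ⊆ insert p F)
    (hq : q ∈ F) {r : Plane} (hr : r ∈ F) : ∃ s' ⊆ insert p F, IsPolygonalArc p r s' := by
  have hball : ∀ x ∈ F, ∀ᶠ w in 𝓝 x, w ∈ F ∧ segment ℝ x w ⊆ F := by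
    intro x hx
    obtain ⟨ε, hε, hb⟩ := Metric.isOpen_iff.1 hF x hx
    filter_upwards [Metric.ball_mem_nhds x hε] with w hw
    exact ⟨hb hw, ((convex_ball x ε).segment_subset (Metric.mem_ball_self hε) hw).trans hb⟩
  have hext : ∀ x ∈ F, ∀ w ∈ F, segment ℝ x w ⊆ F →
      (∃ s' ⊆ insert p F, IsPolygonalArc p x s') → ∃ s' ⊆ insert p F, IsPolygonalArc p w s' := by
    rintro x - w hw hxw ⟨s', hs', harc⟩
    obtain ⟨s'', hs'', harc'⟩ := harc.exists_extend (r := w) (fun e => hp (e ▸ hw))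
    exact ⟨s'', hs''.trans (union_subset hs' (hxw.trans (subset_insert p F))), harc'⟩
  by_contra hcon
  -- Reachable and unreachable points of F both form open sets, since nearby points are joined by
  -- segments inside F.
  let A : Set Plane := {x | x ∈ F ∧ ∃ s' ⊆ insert p F, IsPolygonalArc p x s'}
  let B : Set Plane := {x | x ∈ F ∧ ¬ ∃ s' ⊆ insert p F, IsPolygonalArc p x s'}
  have hA : IsOpen A := by
    rw [isOpen_iff_mem_nhds]
    rintro x ⟨hx, hxs⟩
    filter_upwards [hball x hx] with w hw
    exact ⟨hw.1, hext x hx w hw.1 hw.2 hxs⟩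
  have hB : IsOpen B := by
    rw [isOpen_iff_mem_nhds]
    rintro x ⟨hx, hxs⟩
    filter_upwards [hball x hx] with w hw
    exact ⟨hw.1, fun hws => hxs (hext w hw.1 x hx (by rw [segment_symm]; exact hw.2) hws)⟩
  obtain ⟨x, -, hxA, hxB⟩ := hFc A B hA hB
    (fun x hx => by
      by_cases hxs : ∃ s' ⊆ insert p F, IsPolygonalArc p x s'
      · exact Or.inl ⟨hx, hxs⟩
      · exact Or.inr ⟨hx, hxs⟩)
    ⟨q, hq, hq, s, hs, h⟩ ⟨r, hr, hr, hcon⟩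
  exact hxB.2 hxA.2

/-- Two points of `D` which touch a common face of the complement of `D` can be joined
by a polygonal arc through this face. -/
theorem exists_isPolygonalArc_through_component {D : Set Plane} (hD : IsClosed D)
    (hrad : LocallyRadial D) {y : Plane} (hpD : p ∈ D) (hqD : q ∈ D) (hpq : p ≠ q)
    (hp : p ∈ closure (connectedComponentIn Dᶜ y))
    (hq : q ∈ closure (connectedComponentIn Dᶜ y)) :
    ∃ s, IsPolygonalArc p q s ∧ ∀ x ∈ s, x ∈ D → x = p ∨ x = q := by
  -- Radiality makes boundary points accessible: some straight segment from z runs into the face.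
  have hacc : ∀ z ∈ D, z ∈ closure (connectedComponentIn Dᶜ y) →
      ∃ x ∈ connectedComponentIn Dᶜ y,
        segment ℝ z x ⊆ insert z (connectedComponentIn Dᶜ y) := by
    intro z hzD hz
    obtain ⟨x, hx, hxF⟩ := mem_closure_iff_nhds.1 hz _ (hrad z)
    have hxD : x ∉ D := connectedComponentIn_subset _ _ hxF
    refine ⟨x, hxF, ?_⟩
    have := (mem_closure_connectedComponentIn_of_openSegment hxD (hx hxD)).2
    rw [← connectedComponentIn_eq hxF] at this
    rw [← insert_endpoints_openSegment]
    exact insert_subset_insert (insert_subset hxF this)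
  have hFD : ∀ x ∈ connectedComponentIn Dᶜ y, x ∉ D :=
    fun x hx => connectedComponentIn_subset _ _ hx
  obtain ⟨x, hxF, hx⟩ := hacc p hpD hp
  obtain ⟨w, hwF, hw⟩ := hacc q hqD hq
  obtain ⟨s₁, hs₁, harc⟩ := (isPolygonalArc_segment (p := p) (q := x)
    fun e => hFD x hxF (e ▸ hpD)).exists_of_isPreconnected
    (isOpen_connectedComponentIn_compl hD y) isPreconnected_connectedComponentIn
    (fun h => hFD p h hpD) hx hxF hwF
  obtain ⟨s₂, hs₂, harc₂⟩ := harc.exists_extend hpq.symm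
  refine ⟨s₂, harc₂, fun u hu huD => ?_⟩
  rw [segment_symm] at hs₂
  rcases hs₂ hu with h | h
  · exact (hs₁ h).imp_right fun h => absurd huD (hFD u h)
  · exact (hw h).symm.imp (fun h => absurd huD (hFD u h)) id

end Arc

/-! ### Drawings and their faces -/

namespace SimpleGraph

variable {V : Type*} {G : SimpleGraph V}

namespace PlaneDrawing

/-- The points of the plane covered by the drawing. -/
def carrier (P : G.PlaneDrawing) : Set Plane := range P.pos ∪ ⋃ e ∈ G.edgeSet, P.edge e

/-- The part of the drawing formed by the vertices in `A` and the edges incident with them. -/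
def star (P : G.PlaneDrawing) (A : Set V) : Set Plane :=
  P.pos '' A ∪ ⋃ e ∈ {e ∈ G.edgeSet | ∃ a ∈ A, a ∈ e}, P.edge e

variable (P : G.PlaneDrawing)

theorem pos_mem_carrier (v : V) : P.pos v ∈ P.carrier := Or.inl ⟨v, rfl⟩

theorem edge_subset_carrier {e : Sym2 V} (he : e ∈ G.edgeSet) : P.edge e ⊆ P.carrier :=
  (subset_biUnion_of_mem (u := P.edge) he).trans subset_union_right

theorem star_subset_carrier (A : Set V) : P.star A ⊆ P.carrier :=
  union_subset_union (image_subset_range _ _) (biUnion_subset_biUnion_left fun _ he => he.1)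

theorem isCompact_edge {e : Sym2 V} (he : e ∈ G.edgeSet) : IsCompact (P.edge e) := by
  induction e with
  | _ u v => exact (P.edge_isArc u v he).isCompact

theorem locallyRadial_edge {e : Sym2 V} (he : e ∈ G.edgeSet) : LocallyRadial (P.edge e) := by
  induction e with
  | _ u v => exact (P.edge_isArc u v he).locallyRadial

section Finite

variable [Finite V]

theorem isClosed_carrier : IsClosed P.carrier :=
  (finite_range P.pos).isClosed.union
    (G.edgeSet.toFinite.isClosed_biUnion fun _ he => (P.isCompact_edge he).isClosed)

theorem isClosed_star (A : Set V) : IsClosed (P.star A) :=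
  (A.toFinite.image P.pos).isClosed.union
    ((toFinite _).isClosed_biUnion fun _ he => (P.isCompact_edge he.1).isClosed)

theorem locallyRadial_carrier : LocallyRadial P.carrier := by
  refine LocallyRadial.union ?_
    (LocallyRadial.biUnion G.edgeSet.toFinite fun _ he => P.locallyRadial_edge he)
  rw [← biUnion_of_singleton (range P.pos)]
  exact LocallyRadial.biUnion (finite_range P.pos) fun p _ => locallyRadial_singleton p

theorem eventually_ne_pos (z : Plane) : ∀ᶠ w in 𝓝 z, ∀ v, z ≠ P.pos v → w ≠ P.pos v := by
  refine eventually_all.2 fun v => ?_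
  by_cases h : z = P.pos v
  · exact Eventually.of_forall fun _ h' => absurd h h'
  · filter_upwards [isOpen_ne.mem_nhds h] with w hw _ using hw

/-- The vertices and the other edges form a closed set missing z. -/
theorem eventually_mem_edge_of_mem_carrier {e : Sym2 V} (he : e ∈ G.edgeSet) {z : Plane}
    (hz : z ∈ P.edge e) (hzv : ∀ v ∈ e, z ≠ P.pos v) :
    ∀ᶠ w in 𝓝 z, w ∈ P.carrier → w ∈ P.edge e := by
  have hzpos : ∀ v, z ≠ P.pos v := by
    rintro v rfl
    exact hzv v (P.mem_of_pos_mem_edge e he v hz) rfl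
  have hcl : IsClosed (⋃ f ∈ {f ∈ G.edgeSet | f ≠ e}, P.edge f) :=
    (toFinite _).isClosed_biUnion fun _ hf => (P.isCompact_edge hf.1).isClosed
  have hzn : z ∉ ⋃ f ∈ {f ∈ G.edgeSet | f ≠ e}, P.edge f := by
    intro h
    simp only [mem_iUnion, exists_prop] at h
    obtain ⟨f, ⟨hf, hfe⟩, hzf⟩ := h
    obtain ⟨w, -, -, h⟩ := P.edge_inter_edge f hf e he hfe z hzf hz
    exact hzpos w h
  filter_upwards [hcl.isOpen_compl.mem_nhds hzn, P.eventually_ne_pos z] with w hw hw' hwD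
  rcases hwD with ⟨v, rfl⟩ | hwD
  · exact absurd rfl (hw' v (hzpos v))
  · simp only [mem_iUnion, exists_prop] at hwD
    obtain ⟨f, hf, hwf⟩ := hwD
    by_cases hfe : f = e
    · exact hfe ▸ hwf
    · exact absurd (mem_biUnion (show f ∈ {f ∈ G.edgeSet | f ≠ e} from ⟨hf, hfe⟩) hwf) hw

theorem pos_mem_closure_component {u v : V} (huv : G.Adj u v) {x y : Plane}
    (hx : x ∈ P.edge s(u, v)) (hxu : x ≠ P.pos u)
    (hxF : x ∈ closure (connectedComponentIn P.carrierᶜ y)) :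
    P.pos v ∈ closure (connectedComponentIn P.carrierᶜ y) := by
  refine (P.edge_isArc u v huv).right_mem_closure_component P.isClosed_carrier
    (P.edge_subset_carrier huv) (fun z hz hzu hzv => ?_) hx hxu hxF
  refine P.eventually_mem_edge_of_mem_carrier huv hz fun w hw => ?_
  rcases Sym2.mem_iff.1 hw with rfl | rfl
  · exact hzu
  · exact hzv

/-- Contact slides from x along its edge to the end in A. Only the opposite end is a bad starting
point, and `hxA` puts that vertex in A. -/
theorem exists_pos_mem_closure_of_mem_star {A : Set V} {x y : Plane} (hx : x ∈ P.star A)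
    (hxA : ∀ v, x = P.pos v → v ∈ A) (hxF : x ∈ closure (connectedComponentIn P.carrierᶜ y)) :
    ∃ a ∈ A, P.pos a ∈ closure (connectedComponentIn P.carrierᶜ y) := by
  rcases hx with ⟨a, ha, rfl⟩ | hx
  · exact ⟨a, ha, hxF⟩
  · simp only [mem_iUnion, exists_prop] at hx
    obtain ⟨e, ⟨he, a, ha, hae⟩, hxe⟩ := hx
    obtain ⟨v, rfl⟩ := Sym2.mem_iff_exists.1 hae
    by_cases hxv : x = P.pos v
    · exact ⟨v, hxA v hxv, hxv ▸ hxF⟩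
    · rw [Sym2.eq_swap] at hxe
      exact ⟨a, ha, P.pos_mem_closure_component (G.adj_symm he) hxe hxv hxF⟩

/-- An edge can be drawn between two vertices which touch the same face. -/
theorem isPlanar_sup_edge {u v : V} (huv : u ≠ v) {y : Plane}
    (hu : P.pos u ∈ closure (connectedComponentIn P.carrierᶜ y))
    (hv : P.pos v ∈ closure (connectedComponentIn P.carrierᶜ y)) :
    (G ⊔ SimpleGraph.edge u v).IsPlanar := by
  classical
  by_cases hadj : G.Adj u v
  · rw [sup_eq_left.2 ((SimpleGraph.edge_le_iff G).2 (Or.inr hadj))]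
    exact ⟨P⟩
  obtain ⟨s, harc, hs⟩ := exists_isPolygonalArc_through_component P.isClosed_carrier
    P.locallyRadial_carrier (P.pos_mem_carrier u) (P.pos_mem_carrier v)
    (P.pos_injective.ne huv) hu hv
  have hmem : ∀ e, e ∈ (G ⊔ SimpleGraph.edge u v).edgeSet → e = s(u, v) ∨
      (e ≠ s(u, v) ∧ e ∈ G.edgeSet) := by
    intro e he
    by_cases h : e = s(u, v)
    · exact Or.inl h
    · rw [edgeSet_sup, SimpleGraph.edgeSet_edge_of_ne huv] at he
      exact Or.inr ⟨h, he.resolve_right h⟩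
  -- The new arc runs inside a face except for its ends, so it meets an old edge only at u or v.
  have hcross : ∀ e ∈ G.edgeSet, ∀ x ∈ P.edge e, x ∈ s →
      ∃ w, w ∈ e ∧ w ∈ s(u, v) ∧ x = P.pos w := by
    intro e he x hxe hxs
    rcases hs x hxs (P.edge_subset_carrier he hxe) with rfl | rfl
    · exact ⟨u, P.mem_of_pos_mem_edge e he u hxe, Sym2.mem_mk_left u v, rfl⟩
    · exact ⟨v, P.mem_of_pos_mem_edge e he v hxe, Sym2.mem_mk_right u v, rfl⟩
  refine ⟨⟨P.pos, Function.update P.edge s(u, v) s, P.pos_injective, ?_, ?_, ?_⟩⟩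
  · intro a b hab
    rcases hmem s(a, b) hab with h | ⟨h, h'⟩
    · rw [h, Function.update_self]
      rcases Sym2.eq_iff.1 h with ⟨rfl, rfl⟩ | ⟨rfl, rfl⟩
      · exact harc
      · exact harc.symm
    · rw [Function.update_of_ne h]
      exact P.edge_isArc a b h'
  · intro e he w hw
    rcases hmem e he with rfl | ⟨h, h'⟩
    · rw [Function.update_self] at hw
      rcases hs _ hw (P.pos_mem_carrier w) with h | h
      · rw [P.pos_injective h]; exact Sym2.mem_mk_left u v
      · rw [P.pos_injective h]; exact Sym2.mem_mk_right u v
    · rw [Function.update_of_ne h] at hw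
      exact P.mem_of_pos_mem_edge e h' w hw
  · intro e he f hf hef x hxe hxf
    rcases hmem e he with rfl | ⟨h, h'⟩ <;> rcases hmem f hf with rfl | ⟨k, k'⟩
    · exact absurd rfl hef
    · rw [Function.update_self] at hxe
      rw [Function.update_of_ne k] at hxf
      obtain ⟨w, h1, h2, h3⟩ := hcross f k' x hxf hxe
      exact ⟨w, h2, h1, h3⟩
    · rw [Function.update_self] at hxf
      rw [Function.update_of_ne h] at hxe
      exact hcross e h' x hxe hxf
    · rw [Function.update_of_ne h] at hxe
      rw [Function.update_of_ne k] at hxf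
      exact P.edge_inter_edge e h' f k' hef x hxe hxf

end Finite

end PlaneDrawing

/-! ### Divisions by a 3-clique -/

theorem ThreeClique.Divides.mem_of_adj {k : G.ThreeClique} {S S' : G.Subgraph}
    (h : k.Divides S S') {u v : V} (hu : u ∈ S'.verts) (hv : v ∉ S'.verts) (huv : G.Adj u v) :
    v ∈ k.1 := by
  by_contra hvk
  have hvS : v ∈ S.verts := by
    have : v ∈ S.verts ∪ S'.verts := h.union_verts ▸ hvk
    exact this.resolve_right hv
  have huk : u ∉ k.1 := by
    have : u ∈ S.verts ∪ S'.verts := Or.inr hu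
    rw [h.union_verts] at this
    exact this
  -- An edge from S to S' would be a path avoiding k.
  obtain ⟨w, hw, hwk⟩ := h.path_meets v hvS u hu (Walk.cons huv.symm Walk.nil)
    (by simp [huv.ne'])
  simp only [Walk.support_cons, Walk.support_nil, List.mem_cons, List.not_mem_nil, or_false] at hw
  rcases hw with rfl | rfl
  · exact hvk hwk
  · exact huk hwk

theorem ThreeClique.Divides.verts_right {k : G.ThreeClique} {S S' : G.Subgraph}
    (h : k.Divides S S') : S'.verts = ((k.1 : Set V) ∪ S.verts)ᶜ := by
  rw [compl_union, ← h.union_verts, union_inter_distrib_right, inter_compl_self, empty_union,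
    eq_comm, inter_eq_left]
  exact fun x hx hx' => Set.disjoint_left.1 h.disjoint_verts hx' hx

theorem CliqueLE.union_subset {Gin : G.ThreeClique → G.Subgraph} {k₁ k₂ : G.ThreeClique}
    (h : CliqueLE Gin k₁ k₂) :
    (k₁.1 : Set V) ∪ (Gin k₁).verts ⊆ (k₂.1 : Set V) ∪ (Gin k₂).verts := h.1

/-! ### Consequences of maximal planarity -/

variable [Finite V]

theorem IsMaximalPlanar.adj_of_mem_closure (hG : G.IsMaximalPlanar) (P : G.PlaneDrawing)
    {u v : V} (huv : u ≠ v) {y : Plane}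
    (hu : P.pos u ∈ closure (connectedComponentIn P.carrierᶜ y))
    (hv : P.pos v ∈ closure (connectedComponentIn P.carrierᶜ y)) : G.Adj u v :=
  hG.2 (P.isPlanar_sup_edge huv hu hv) le_sup_left
    (show (G ⊔ SimpleGraph.edge u v).Adj u v from
      Or.inr ((SimpleGraph.edge_adj u v u v).2 ⟨Or.inl ⟨rfl, rfl⟩, huv⟩))

/-- If a connected open region of the plane meets both the part of a drawing around `A` and the
part around `B`, but nothing else of the drawing, then maximal planarity yields an edge between
`A` and `B`. -/
theorem IsMaximalPlanar.exists_adj_of_region (hG : G.IsMaximalPlanar) (P : G.PlaneDrawing)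
    {A B : Set V} (hAB : Disjoint A B) {U : Set Plane} (hUo : IsOpen U) (hU : IsPreconnected U)
    (hpos : ∀ v, P.pos v ∈ U → v ∈ A ∪ B)
    (hedge : ∀ e ∈ G.edgeSet, ∀ x ∈ P.edge e, x ∈ U → ∃ a ∈ A ∪ B, a ∈ e)
    (hUA : (U ∩ P.star A).Nonempty) (hUB : (U ∩ P.star B).Nonempty) :
    ∃ a ∈ A, ∃ b ∈ B, G.Adj a b := by
  by_contra! hna
  have hnin : ∀ e ∈ G.edgeSet, ∀ a ∈ A, a ∈ e → ∀ b ∈ B, b ∉ e := by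
    rintro e he a ha hae b hb hbe
    have hne : a ≠ b := fun h => Set.disjoint_left.1 hAB ha (h ▸ hb)
    rw [(Sym2.mem_and_mem_iff hne).1 ⟨hae, hbe⟩] at he
    exact hna a ha b hb he
  obtain ⟨y, -, ⟨x₁, ⟨hx₁, hxA⟩, hF₁⟩, x₂, ⟨hx₂, hxB⟩, hF₂⟩ :=
    exists_component_closure_meets_both P.isClosed_carrier P.locallyRadial_carrier hUo hU
      (P.isClosed_star A) (P.isClosed_star B) (P.star_subset_carrier A) (P.star_subset_carrier B)
      (by
        rintro x ⟨hxU, ⟨v, rfl⟩ | hx⟩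
        · exact (hpos v hxU).imp (fun h => Or.inl ⟨v, h, rfl⟩) fun h => Or.inl ⟨v, h, rfl⟩
        · simp only [mem_iUnion, exists_prop] at hx
          obtain ⟨e, he, hxe⟩ := hx
          obtain ⟨a, ha, hae⟩ := hedge e he x hxe hxU
          exact ha.imp
            (fun h => Or.inr (mem_biUnion (show e ∈ {e ∈ G.edgeSet | ∃ a ∈ A, a ∈ e} from
              ⟨he, a, h, hae⟩) hxe))
            (fun h => Or.inr (mem_biUnion (show e ∈ {e ∈ G.edgeSet | ∃ a ∈ B, a ∈ e} from
              ⟨he, a, h, hae⟩) hxe)))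
      -- The two stars are disjoint inside U: edges from different stars can only meet at a common
      -- end, which in U belongs to A or B and so yields an edge between A and B.
      (by
        rintro x hxU hxA hxB
        rcases hxA with ⟨a, ha, rfl⟩ | hxA <;> rcases hxB with ⟨b, hb, hxb⟩ | hxB
        · exact Set.disjoint_left.1 hAB ha (P.pos_injective hxb ▸ hb)
        · simp only [mem_iUnion, exists_prop] at hxB
          obtain ⟨e, ⟨he, b, hb, hbe⟩, hxe⟩ := hxB
          exact hnin e he a ha (P.mem_of_pos_mem_edge e he a hxe) b hb hbe
        · simp only [mem_iUnion, exists_prop] at hxA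
          obtain ⟨e, ⟨he, a, ha, hae⟩, hxe⟩ := hxA
          exact hnin e he a ha hae b hb (P.mem_of_pos_mem_edge e he b (hxb ▸ hxe))
        · simp only [mem_iUnion, exists_prop] at hxA hxB
          obtain ⟨e, ⟨he, a, ha, hae⟩, hxe⟩ := hxA
          obtain ⟨f, ⟨hf, b, hb, hbf⟩, hxf⟩ := hxB
          obtain ⟨w, hwe, hwf, rfl⟩ := P.edge_inter_edge e he f hf
            (fun h => hnin e he a ha hae b hb (h ▸ hbf)) x hxe hxf
          rcases hpos w hxU with hw | hw
          · exact hnin f hf w hw hwf b hb hbf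
          · exact hnin e he a ha hae w hw hwe)
      hUA hUB
  obtain ⟨a, ha, haF⟩ : ∃ a ∈ A, P.pos a ∈ closure (connectedComponentIn P.carrierᶜ y) := by
    -- Were x₁ a vertex outside A, it would be in B and on an edge with an end in A.
    by_cases h : ∃ v, x₁ = P.pos v ∧ v ∉ A
    · obtain ⟨v, rfl, hv⟩ := h
      have hvB : v ∈ B := (hpos v hx₁).resolve_left hv
      rcases hxA with ⟨a, ha, e⟩ | hxA
      · exact absurd (P.pos_injective e ▸ ha) hv
      · simp only [mem_iUnion, exists_prop] at hxA
        obtain ⟨e, ⟨he, a, ha, hae⟩, hxe⟩ := hxA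
        exact absurd (P.mem_of_pos_mem_edge e he v hxe) (hnin e he a ha hae v hvB)
    · push Not at h
      exact P.exists_pos_mem_closure_of_mem_star hxA h hF₁
  obtain ⟨b, hb, hbF⟩ : ∃ b ∈ B, P.pos b ∈ closure (connectedComponentIn P.carrierᶜ y) := by
    by_cases h : ∃ v, x₂ = P.pos v ∧ v ∉ B
    · obtain ⟨v, rfl, hv⟩ := h
      have hvA : v ∈ A := (hpos v hx₂).resolve_right hv
      rcases hxB with ⟨b, hb, e⟩ | hxB
      · exact absurd (P.pos_injective e ▸ hb) hv
      · simp only [mem_iUnion, exists_prop] at hxB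
        obtain ⟨e, ⟨he, b, hb, hbe⟩, hxe⟩ := hxB
        exact absurd hbe (hnin e he v hvA (P.mem_of_pos_mem_edge e he v hxe) b hb)
    · push Not at h
      exact P.exists_pos_mem_closure_of_mem_star hxB h hF₂
  exact hna a ha b hb
    (hG.adj_of_mem_closure P (fun h => Set.disjoint_left.1 hAB ha (h ▸ hb)) haF hbF)

/-- A maximal planar graph is connected. -/
theorem IsMaximalPlanar.exists_adj_compl (hG : G.IsMaximalPlanar) {A : Set V} (hA : A.Nonempty)
    (hA' : Aᶜ.Nonempty) : ∃ a ∈ A, ∃ b ∈ Aᶜ, G.Adj a b := by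
  obtain ⟨P⟩ := hG.1
  refine hG.exists_adj_of_region P disjoint_compl_right isOpen_univ isPreconnected_univ
    (fun v _ => by simp) (fun e he x _ _ => ?_)
    (hA.imp' P.pos fun a ha => ⟨mem_univ _, Or.inl ⟨a, ha, rfl⟩⟩)
    (hA'.imp' P.pos fun a ha => ⟨mem_univ _, Or.inl ⟨a, ha, rfl⟩⟩)
  induction e with
  | _ u v => exact ⟨u, by simp, Sym2.mem_mk_left u v⟩

/-- The ends `a`, `d` of an edge do not separate neighbours of `a`
in a maximal planar graph. -/
theorem IsMaximalPlanar.exists_adj_compl_pair (hG : G.IsMaximalPlanar) {A : Set V} {a d u v : V}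
    (had : G.Adj a d) (haA : a ∉ A) (hdA : d ∉ A) (hu : u ∈ A) (hau : G.Adj a u)
    (hv : v ∉ A) (hvd : v ≠ d) (hav : G.Adj a v) : ∃ x ∈ A, ∃ y ∉ A, y ≠ a ∧ y ≠ d ∧ G.Adj x y := by
  obtain ⟨P⟩ := hG.1
  obtain ⟨y, hy, hyD, hyloc⟩ := (P.edge_isArc a d had).exists_initial_segment
  -- The disc is so small that a is its only vertex and the edge ad stays on the slit.
  obtain ⟨r, hr, hball⟩ := Metric.eventually_nhds_iff_ball.1
    (hyloc.and (P.eventually_ne_pos (P.pos a)))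
  have hstar : ∀ (S : Set V) (w : V), w ∈ S → w ≠ d → G.Adj a w →
      ((Metric.ball (P.pos a) r \ rayFrom (P.pos a) y) ∩ P.star S).Nonempty := by
    intro S w hw hwd haw
    obtain ⟨y₁, hy₁, hyD₁, -⟩ := (P.edge_isArc a w haw).exists_initial_segment
    have hdisj : ∀ x ∈ segment ℝ (P.pos a) y₁, x ∈ segment ℝ (P.pos a) y → x = P.pos a := by
      intro x hx hx'
      obtain ⟨b, hb, hb', rfl⟩ := P.edge_inter_edge s(a, w) haw s(a, d) had
        (fun h => hwd (Sym2.congr_right.1 h)) x (hyD₁ hx) (hyD hx')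
      rcases Sym2.mem_iff.1 hb with rfl | rfl
      · rfl
      · rcases Sym2.mem_iff.1 hb' with rfl | rfl
        · rfl
        · exact absurd rfl hwd
    have hn : 0 < ‖y₁ - P.pos a‖ := norm_pos_iff.2 (sub_ne_zero.2 hy₁)
    -- The bound 1 keeps the point on the initial segment of the edge aw, the other bound keeps it
    -- in the disc.
    have ht : 0 < min 1 (r / (2 * ‖y₁ - P.pos a‖)) := lt_min one_pos (by positivity)
    refine ⟨P.pos a + min 1 (r / (2 * ‖y₁ - P.pos a‖)) • (y₁ - P.pos a),
      ⟨?_, notMem_rayFrom_of_segment_inter hdisj hy₁ ht⟩, Or.inr ?_⟩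
    · rw [Metric.mem_ball, dist_eq_norm, add_sub_cancel_left, norm_smul,
        Real.norm_of_nonneg ht.le]
      calc _ ≤ r / (2 * ‖y₁ - P.pos a‖) * ‖y₁ - P.pos a‖ :=
            mul_le_mul_of_nonneg_right (min_le_right _ _) hn.le
        _ = r / 2 := by field_simp
        _ < r := half_lt_self hr
    · exact mem_biUnion (show s(a, w) ∈ {e ∈ G.edgeSet | ∃ a ∈ S, a ∈ e} from
        ⟨haw, w, hw, Sym2.mem_mk_right a w⟩)
        (hyD₁ (mem_segment_iff_add_smul.2 ⟨_, ht.le, min_le_left _ _, rfl⟩))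
  -- With this B, the only possible edge without an end in A ∪ B is ad, which the slit removes.
  obtain ⟨x, hx, b, hb, hxb⟩ := hG.exists_adj_of_region P (A := A) (B := (A ∪ {a, d})ᶜ)
    (disjoint_compl_right.mono_right (compl_subset_compl.2 subset_union_left))
    (Metric.isOpen_ball.sdiff (isClosed_rayFrom (P.pos a) y))
    (isPreconnected_ball_diff_rayFrom hy hr)
    (by
      rintro w ⟨hw, hwr⟩
      have hwa : w ≠ a := by
        rintro rfl
        exact hwr (self_mem_rayFrom _ _)
      exact absurd rfl ((hball _ hw).2 w (P.pos_injective.ne hwa.symm)))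
    (by
      rintro e he x hxe ⟨hx, hxr⟩
      by_contra! hcon
      have hout : ∀ w ∈ e, w = a ∨ w = d := by
        intro w hw
        by_contra hwad
        by_cases hwA : w ∈ A
        · exact hcon w (Or.inl hwA) hw
        · exact hcon w (Or.inr (by simpa [hwA] using hwad)) hw
      have : e = s(a, d) := by
        induction e with
        | _ b c =>
          have hbc : b ≠ c := G.ne_of_adj he
          rcases hout b (Sym2.mem_mk_left b c) with rfl | rfl <;>
            rcases hout c (Sym2.mem_mk_right _ c) with rfl | rfl
          · exact absurd rfl hbc
          · rfl
          · exact Sym2.eq_swap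
          · exact absurd rfl hbc
      subst this
      exact hxr (segment_subset_rayFrom _ _ ((hball x hx).1 hxe)))
    (hstar A u hu (fun h => hdA (h ▸ hu)) hau)
    (hstar _ v (by simp [hv, hvd, hav.ne']) hvd hav)
  simp only [mem_compl_iff, mem_union, mem_insert_iff, mem_singleton_iff, not_or] at hb
  exact ⟨x, hx, b, hb.1, hb.2.1, hb.2.2, hxb⟩

/-! ### Antisymmetry -/

theorem IsMaximalPlanar.cliqueLE_antisymm (hG : G.IsMaximalPlanar)
    {Gin Gout : G.ThreeClique → G.Subgraph}
    (hinout : ∀ k : G.ThreeClique, k.IsInteriorExterior (Gin k) (Gout k)) {k₁ k₂ : G.ThreeClique}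
    (h₁₂ : CliqueLE Gin k₁ k₂) (h₂₁ : CliqueLE Gin k₂ k₁) : k₁ = k₂ := by
  classical
  have heq := h₁₂.union_subset.antisymm h₂₁.union_subset
  have hcard : ∀ k : G.ThreeClique, k.1.card = 3 := fun k => k.2.card_eq
  by_contra hne
  have hnsub : ¬ k₁.1 ⊆ k₂.1 := fun h =>
    hne (Subtype.ext (Finset.eq_of_subset_of_card_le h (by rw [hcard, hcard])))
  have hnsub' : ¬ k₂.1 ⊆ k₁.1 := fun h =>
    hne (Subtype.ext (Finset.eq_of_subset_of_card_le h (by rw [hcard, hcard])).symm)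
  obtain ⟨c, hc₁, hc₂⟩ := Finset.not_subset.1 hnsub
  have hO₁ := (hinout k₁).divides.verts_right
  have hO₂ := (hinout k₂).divides.verts_right
  -- Each exterior is the complement of the closed interior, so the two exteriors have the same
  -- vertices.
  rw [← heq, ← hO₁] at hO₂
  have hout : ∀ v ∈ k₁.1, v ∉ (Gout k₁).verts := by
    intro v hv hvO
    rw [hO₁] at hvO
    exact hvO (Or.inl hv)
  have hnbr : ∀ x ∈ (Gout k₁).verts, ∀ v ∉ (Gout k₁).verts, G.Adj x v → v ∈ k₁.1 ∧ v ∈ k₂.1 :=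
    fun x hx v hv hxv => ⟨(hinout k₁).divides.mem_of_adj hx hv hxv,
      (hinout k₂).divides.mem_of_adj (hO₂ ▸ hx) (hO₂ ▸ hv) hxv⟩
  -- An empty exterior forces an empty interior by the order condition; the common closed interior
  -- is then k₁ alone and contains k₂.
  have hOne : (Gout k₁).verts.Nonempty := by
    by_contra hemp
    rw [not_nonempty_iff_eq_empty] at hemp
    have hle := (hinout k₁).order_le
    rw [hemp, ncard_empty, Nat.le_zero, ncard_eq_zero (toFinite _)] at hle
    refine hnsub' fun x hx => ?_
    have : x ∈ (k₁.1 : Set V) ∪ (Gin k₁).verts := heq ▸ Or.inl hx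
    rw [hle, union_empty] at this
    exact this
  obtain ⟨u, hu, a, ha, hua⟩ := hG.exists_adj_compl hOne ⟨c, hout c hc₁⟩
  obtain ⟨ha₁, ha₂⟩ := hnbr u hu a ha hua
  have hac : a ≠ c := fun h => hc₂ (h ▸ ha₂)
  have hclique : ∀ x ∈ k₁.1, ∀ y ∈ k₁.1, x ≠ y → G.Adj x y := fun x hx y hy hxy =>
    k₁.2.isClique hx hy hxy
  obtain ⟨d, hd⟩ : ((k₁.1.erase a).erase c).Nonempty := by
    rw [← Finset.card_pos, Finset.card_erase_of_mem (by simp [hac.symm, hc₁]),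
      Finset.card_erase_of_mem ha₁, hcard]
    norm_num
  simp only [Finset.mem_erase] at hd
  obtain ⟨hdc, hda, hd₁⟩ := hd
  have hk : k₁.1 = {a, c, d} := by
    refine (Finset.eq_of_subset_of_card_le ?_ ?_).symm
    · intro x hx
      simp only [Finset.mem_insert, Finset.mem_singleton] at hx
      rcases hx with rfl | rfl | rfl <;> assumption
    · rw [hcard, Finset.card_eq_three.2 ⟨a, c, d, hac, hda.symm, hdc.symm, rfl⟩]
  -- The neighbours of a to be connected are u in the exterior and c outside it; the resulting y can
  -- only be c.
  obtain ⟨x, hx, y, hy, hya, hyd, hxy⟩ := hG.exists_adj_compl_pair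
    (hclique a ha₁ d hd₁ hda.symm) ha (hout d hd₁) hu hua.symm (hout c hc₁) hdc.symm
    (hclique a ha₁ c hc₁ hac)
  obtain ⟨hy₁, hy₂⟩ := hnbr x hx y hy hxy
  rw [hk] at hy₁
  simp only [Finset.mem_insert, Finset.mem_singleton] at hy₁
  rcases hy₁ with h | rfl | h
  · exact hya h
  · exact hc₂ hy₂
  · exact hyd h

end SimpleGraph

/-- For every assignment of interiors and exteriors to the 3-cliques of a finite maximal planar
graph, the relation `≼` is reflexive, antisymmetric and transitive. -/
theorem mainTheorem7 {V : Type*} [Finite V] (G : SimpleGraph V) (hG : G.IsMaximalPlanar)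
    (Gin Gout : G.ThreeClique → G.Subgraph)
    (hinout : ∀ k : G.ThreeClique, k.IsInteriorExterior (Gin k) (Gout k)) :
    (∀ k : G.ThreeClique, SimpleGraph.CliqueLE Gin k k) ∧
    (∀ k₁ k₂ : G.ThreeClique,
      SimpleGraph.CliqueLE Gin k₁ k₂ → SimpleGraph.CliqueLE Gin k₂ k₁ → k₁ = k₂) ∧
    (∀ k₁ k₂ k₃ : G.ThreeClique,
      SimpleGraph.CliqueLE Gin k₁ k₂ → SimpleGraph.CliqueLE Gin k₂ k₃ →
        SimpleGraph.CliqueLE Gin k₁ k₃) :=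
  ⟨fun _ => le_rfl, fun _ _ h₁ h₂ => hG.cliqueLE_antisymm hinout h₁ h₂,
    fun _ _ _ h₁ h₂ => le_trans (α := G.Subgraph) h₁ h₂⟩
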